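/- Let $n\ge 1$, $s,\tilde s\in\mathbb R$, $0<p<\infty$, $0<q,r\le\infty$, with $1/\infty=0$. For $j\in\mathbb Z$ let $A_j=\{x\in\mathbb R^n: 2^{j-1}\le|x|<2^j\}$. The Herz space $\dot K^s_{q,r}(\mathbb R^n)$ consists of all measurable functions $f$ on $\mathbb R^n$ (real- or complex-valued, identified when equal almost everywhere) with $$\|f\|_{\dot K^s_{q,r}}=\Big(\sum_{j\in\mathbb Z}\big[2^{js}\|f\chi_{A_j}\|_{L^q}\big]^r\Big)^{1/r}<\infty\quad(r<\infty),\qquad \|f\|_{\dot K^s_{q,\infty}}=\sup_{j\in\mathbb Z}2^{js}\|f\chi_{A_j}\|_{L^q}<\infty .$$ For measurable $g$ let $g^*(t)=\inf\{\lambda>0:|\{x\in\mathbb R^n:|g(x)|>\lambda\}|\le t\}$ for $t>0$ (with $\inf\emptyset=\infty$), and $$\|g\|_{L^{p,r}}=\Big(\int_0^\infty\big[t^{1/p}g^*(t)\big]^r\,\frac{dt}{t}\Big)^{1/r}\quad(r<\infty),\qquad \|g\|_{L^{p,\infty}}=\sup_{t>0}t^{1/p}g^*(t).$$ The weighted Lorentz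 space $L^{p,r}_{\tilde s}(\mathbb R^n)$ consists of all measurable $f$ with $\|f\|_{L^{p,r}_{\tilde s}}=\big\||\cdot|^{\tilde s}f\big\|_{L^{p,r}}<\infty$. Suppose that $$\frac sn+\frac1q=\frac{\tilde s}n+\frac1p .$$ 1. If $s<\tilde s$, then $L^{p,r}_{\tilde s}(\mathbb R^n)\hookrightarrow\dot K^s_{q,r}(\mathbb R^n)$: there is a constant $C<\infty$ such that every $f\in L^{p,r}_{\tilde s}(\mathbb R^n)$ belongs to $\dot K^s_{q,r}(\mathbb R^n)$ and satisfies $\|f\|_{\dot K^s_{q,r}}\le C\|f\|_{L^{p,r}_{\tilde s}}$. 2. If $s>\tilde s$, then $\dot K^s_{q,r}(\mathbb R^n)\hookrightarrow L^{p,r}_{\tilde s}(\mathbb R^n)$: there is a constant $C<\infty$ such that every $f\in\dot K^s_{q,r}(\mathbb R^n)$ belongs to $L^{p,r}_{\tilde s}(\mathbb R^n)$ and satisfies $\|f\|_{L^{p,r}_{\tilde s}}\le C\|f\|_{\dot K^s_{q,r}}$. -/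

import Mathlib

open MeasureTheory
open scoped ENNReal NNReal

noncomputable section

namespace HerzLorentz

/-- The dyadic annulus `A_j = {x ∈ ℝⁿ : 2^(j-1) ≤ |x| < 2^j}`. -/
def annulus (n : ℕ) (j : ℤ) : Set (EuclideanSpace ℝ (Fin n)) :=
  {x | (2 : ℝ) ^ (j - 1) ≤ ‖x‖ ∧ ‖x‖ < (2 : ℝ) ^ j}

variable {𝕜 : Type*} [RCLike 𝕜] {n : ℕ}

/-- The quasi-norm of the homogeneous Herz space with smoothness index `s` and exponents `q`, `r`,
with values in `[0, ∞]`. -/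
def herzNorm (s : ℝ) (q r : ℝ≥0∞) (f : EuclideanSpace ℝ (Fin n) → 𝕜) : ℝ≥0∞ :=
  if r = ∞ then
    ⨆ j : ℤ, (2 : ℝ≥0∞) ^ ((j : ℝ) * s) * eLpNorm ((annulus n j).indicator f) q volume
  else
    (∑' j : ℤ, ((2 : ℝ≥0∞) ^ ((j : ℝ) * s) *
      eLpNorm ((annulus n j).indicator f) q volume) ^ r.toReal) ^ (1 / r.toReal)

/-- Membership in the homogeneous Herz space: `f` is (Lebesgue) measurable and its quasi-norm
is finite. -/
def MemHerz (s : ℝ) (q r : ℝ≥0∞) (f : EuclideanSpace ℝ (Fin n) → 𝕜) : Prop :=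
  AEStronglyMeasurable f volume ∧ herzNorm s q r f < ∞

/-- The decreasing rearrangement `f*(t) = inf {λ > 0 : |{x : |f x| > λ}| ≤ t}`, with values in
`[0, ∞]` (the infimum of the empty set is `∞`). -/
def rearrangement (f : EuclideanSpace ℝ (Fin n) → 𝕜) (t : ℝ) : ℝ≥0∞ :=
  sInf {l : ℝ≥0∞ | 0 < l ∧ volume {x | l < ‖f x‖ₑ} ≤ ENNReal.ofReal t}

/-- The quasi-norm of the Lorentz space `L^{p,r}`, with values in `[0, ∞]`. -/
def lorentzNorm (p : ℝ) (r : ℝ≥0∞) (f : EuclideanSpace ℝ (Fin n) → 𝕜) : ℝ≥0∞ :=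
  if r = ∞ then
    ⨆ (t : ℝ) (_ : 0 < t), ENNReal.ofReal t ^ (1 / p) * rearrangement f t
  else
    (∫⁻ t in Set.Ioi (0 : ℝ),
      (ENNReal.ofReal t ^ (1 / p) * rearrangement f t) ^ r.toReal / ENNReal.ofReal t)
        ^ (1 / r.toReal)

/-- The quasi-norm of the Lorentz space with power weight: the Lorentz quasi-norm of `|x|^s f`. -/
def weightedLorentzNorm (s p : ℝ) (r : ℝ≥0∞) (f : EuclideanSpace ℝ (Fin n) → 𝕜) : ℝ≥0∞ :=
  lorentzNorm p r (fun x => ((‖x‖ ^ s : ℝ) : 𝕜) * f x)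

/-- Membership in the Lorentz space with power weight: `f` is (Lebesgue) measurable and its
quasi-norm is finite. -/
def MemWeightedLorentz (s p : ℝ) (r : ℝ≥0∞) (f : EuclideanSpace ℝ (Fin n) → 𝕜) : Prop :=
  AEStronglyMeasurable f volume ∧ weightedLorentzNorm s p r f < ∞

end HerzLorentz

end

noncomputable section

namespace HerzLorentz

/-! Both quasi-norms are reduced to `ℓ^r` quasi-norms of sequences indexed by dyadic scales. The
Herz norm has this form by definition. For the Lorentz norm, monotonicity of `g*` allows sampling
`t^{1/p} g*(t)` on the mesh `t = D 2^{nj}`, at bounded cost in either direction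
(`exists_seqNorm_le_lorentzNorm`, `exists_lorentzNorm_le_seqNorm`). With `D` the volume of the unit
ball, `D 2^{nj}` is the volume of the ball of radius `2^j`.

Put `g = |x|^{st} f` and `ε = |s - st| / 2`. On the annulus `A_j` the weight is comparable to `2^{j
st}`, and the scaling relation turns the gap between `s` and `st` into the gap `2ε = |n/q - n/p|`.
Half of it makes a geometric series of level sets or annuli converge; the other half is left as
damping `2^{-εm}`. If `s < st`, the `j`-th Herz term is bounded by the damped supremum of the
Lorentz samples at scales `j - m`: `g*` at smaller scales controls the high superlevel sets, and
`A_j` has bounded volume for the low ones (`exists_annulus_eLpNorm_le`). If `st < s`, the `k`-th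
Lorentz sample is bounded by the damped supremum of the Herz terms at `k + m`: the ball of radius
`2^k` is discarded and Chebyshev's inequality is used on the annuli outside it
(`exists_rearrangement_le`). Damped suprema of shifts are bounded on `ℓ^r`
(`exists_seqNorm_iSup_le`), which concludes. -/

/-! ### Sequence quasi-norms and damped suprema. -/

/-- The `ℓ^r` quasi-norm of a two-sided sequence with values in `[0, ∞]`. -/
def seqNorm (r : ℝ≥0∞) (a : ℤ → ℝ≥0∞) : ℝ≥0∞ :=
  if r = ∞ then ⨆ j, a j else (∑' j, a j ^ r.toReal) ^ (1 / r.toReal)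

theorem herzNorm_eq_seqNorm {𝕜 : Type*} [RCLike 𝕜] {n : ℕ} (s : ℝ) (q r : ℝ≥0∞)
    (f : EuclideanSpace ℝ (Fin n) → 𝕜) :
    herzNorm s q r f = seqNorm r fun j : ℤ =>
      (2 : ℝ≥0∞) ^ ((j : ℝ) * s) * eLpNorm ((annulus n j).indicator f) q volume := rfl

theorem seqNorm_mono (r : ℝ≥0∞) {a b : ℤ → ℝ≥0∞} (h : ∀ j, a j ≤ b j) :
    seqNorm r a ≤ seqNorm r b := by
  unfold seqNorm
  split_ifs
  · exact iSup_mono h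
  · gcongr with j
    exact h j

theorem seqNorm_const_mul {r : ℝ≥0∞} (hr : 0 < r) (C : ℝ≥0∞) (a : ℤ → ℝ≥0∞) :
    seqNorm r (fun j => C * a j) = C * seqNorm r a := by
  unfold seqNorm
  split_ifs with h
  · rw [ENNReal.mul_iSup]
  · have hr' : 0 < r.toReal := ENNReal.toReal_pos hr.ne' h
    simp_rw [ENNReal.mul_rpow_of_nonneg _ _ hr'.le]
    rw [ENNReal.tsum_mul_left, ENNReal.mul_rpow_of_nonneg _ _ (by positivity), ← ENNReal.rpow_mul,
      mul_one_div_cancel hr'.ne', ENNReal.rpow_one]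

theorem seqNorm_le_of_le {r : ℝ≥0∞} (hr : 0 < r) {C : ℝ≥0∞} {a b : ℤ → ℝ≥0∞}
    (h : ∀ j, a j ≤ C * b j) : seqNorm r a ≤ C * seqNorm r b :=
  (seqNorm_mono r h).trans_eq (seqNorm_const_mul hr C b)

/-- Geometrically damped maximal functions of sequences are bounded on `ℓ^r`. -/
theorem exists_seqNorm_iSup_le {r : ℝ≥0∞} (hr : 0 < r) {ρ : ℝ≥0∞} (hρ : ρ < 1)
    (σ : ℕ → ℤ ≃ ℤ) :
    ∃ C : ℝ≥0∞, C ≠ ∞ ∧ ∀ a : ℤ → ℝ≥0∞,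
      seqNorm r (fun j => ⨆ m : ℕ, ρ ^ m * a (σ m j)) ≤ C * seqNorm r a := by
  by_cases h : r = ∞
  · refine ⟨1, ENNReal.one_ne_top, fun a => ?_⟩
    simp only [seqNorm, h, if_true, one_mul]
    refine iSup_le fun j => iSup_le fun m => ?_
    calc ρ ^ m * a (σ m j) ≤ 1 * a (σ m j) := by gcongr; exact pow_le_one' hρ.le m
      _ ≤ ⨆ j, a j := by rw [one_mul]; exact le_iSup a _
  · have hr' : 0 < r.toReal := ENNReal.toReal_pos hr.ne' h
    have hρr : ρ ^ r.toReal < 1 := ENNReal.rpow_lt_one hρ hr'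
    refine ⟨((1 - ρ ^ r.toReal)⁻¹) ^ (1 / r.toReal), ?_, fun a => ?_⟩
    · refine ENNReal.rpow_ne_top_of_nonneg (by positivity) ?_
      simpa [tsub_eq_zero_iff_le] using hρr
    · simp only [seqNorm, h, if_false]
      rw [← ENNReal.mul_rpow_of_nonneg _ _ (by positivity : 0 ≤ 1 / r.toReal)]
      gcongr
      -- Bounding a supremum by a sum after taking `r`-th powers avoids the triangle inequality, so
      -- `r < 1` needs no separate treatment. Each bijection `σ m` preserves the sum over `j`,
      -- leaving a geometric series in `m`.
      calc ∑' j, (⨆ m : ℕ, ρ ^ m * a (σ m j)) ^ r.toReal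
          ≤ ∑' j, ∑' m : ℕ, (ρ ^ m * a (σ m j)) ^ r.toReal := by
            refine ENNReal.tsum_le_tsum fun j => ?_
            rw [← ENNReal.le_rpow_inv_iff hr']
            refine iSup_le fun m => ?_
            rw [ENNReal.le_rpow_inv_iff hr']
            exact ENNReal.le_tsum (f := fun m : ℕ => (ρ ^ m * a (σ m j)) ^ r.toReal) m
        _ = ∑' m : ℕ, (ρ ^ r.toReal) ^ m * ∑' j, a j ^ r.toReal := by
            rw [ENNReal.tsum_comm]
            refine tsum_congr fun m => ?_
            rw [← (σ m).tsum_eq fun j => a j ^ r.toReal, ← ENNReal.tsum_mul_left]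
            refine tsum_congr fun j => ?_
            rw [ENNReal.mul_rpow_of_nonneg _ _ hr'.le, ← ENNReal.rpow_natCast,
              ← ENNReal.rpow_natCast, ← ENNReal.rpow_mul, ← ENNReal.rpow_mul, mul_comm (m : ℝ)]
        _ = (1 - ρ ^ r.toReal)⁻¹ * ∑' j, a j ^ r.toReal := by
            rw [ENNReal.tsum_mul_right, ENNReal.tsum_geometric]

/-! ### Discretization of the Lorentz quasi-norm. -/

theorem rearrangement_antitone {𝕜 : Type*} [RCLike 𝕜] {n : ℕ}
    (f : EuclideanSpace ℝ (Fin n) → 𝕜) : Antitone (rearrangement f) := fun _ _ h =>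
  sInf_le_sInf fun _ hl => ⟨hl.1, hl.2.trans (ENNReal.ofReal_le_ofReal h)⟩

/-- The mesh `D * b ^ j` is monotone in `j`. -/
theorem monotone_mul_zpow {D b : ℝ} (hD : 0 < D) (hb : 1 < b) :
    Monotone fun j : ℤ => D * b ^ j := fun i j h => by
  have := zpow_le_zpow_right₀ hb.le h
  dsimp only
  gcongr

theorem iUnion_Ioc_mul_zpow {D b : ℝ} (hD : 0 < D) (hb : 1 < b) :
    ⋃ j : ℤ, Set.Ioc (D * b ^ j) (D * b ^ Order.succ j) = Set.Ioi 0 := by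
  ext t
  simp only [Set.mem_iUnion, Set.mem_Ioi]
  constructor
  · rintro ⟨j, hj, -⟩
    exact lt_trans (by positivity) hj
  · intro ht
    obtain ⟨j, h1, h2⟩ := exists_mem_Ioc_zpow (div_pos ht hD) hb
    exact ⟨j, by rwa [lt_div_iff₀ hD, mul_comm] at h1, by rwa [div_le_iff₀ hD, mul_comm] at h2⟩

theorem lintegral_Ioi_eq_tsum {D b : ℝ} (hD : 0 < D) (hb : 1 < b) (F : ℝ → ℝ≥0∞) :
    ∫⁻ t in Set.Ioi (0 : ℝ), F t =
      ∑' j : ℤ, ∫⁻ t in Set.Ioc (D * b ^ j) (D * b ^ Order.succ j), F t := by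
  rw [← iUnion_Ioc_mul_zpow hD hb, lintegral_iUnion (fun _ => measurableSet_Ioc)]
  exact (monotone_mul_zpow hD hb).pairwise_disjoint_on_Ioc_succ

theorem volume_Ioc_mul_zpow (D : ℝ) {b : ℝ} (hb : 1 < b) (j : ℤ) :
    volume (Set.Ioc (D * b ^ j) (D * b ^ Order.succ j)) =
      ENNReal.ofReal (b - 1) * ENNReal.ofReal (D * b ^ j) := by
  have hb0 : b ≠ 0 := by positivity
  rw [Real.volume_Ioc, ← ENNReal.ofReal_mul (by linarith)]
  congr 1
  rw [Order.succ_eq_add_one, zpow_add_one₀ hb0]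
  ring

/-- The Lorentz quasi-norm of a monotone profile is controlled by its values on a geometric
mesh. -/
theorem exists_lorentzNorm_le_seqNorm {𝕜 : Type*} [RCLike 𝕜] {n : ℕ} {p : ℝ} (hp : 0 < p)
    {r : ℝ≥0∞} (hr : 0 < r) {D b : ℝ} (hD : 0 < D) (hb : 1 < b) :
    ∃ C : ℝ≥0∞, C ≠ ∞ ∧ ∀ f : EuclideanSpace ℝ (Fin n) → 𝕜, lorentzNorm p r f ≤
      C * seqNorm r fun j : ℤ =>
        ENNReal.ofReal (D * b ^ j) ^ (1 / p) * rearrangement f (D * b ^ j) := by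
  have hp' : 0 ≤ 1 / p := by positivity
  have hb0 : b ≠ 0 := by positivity
  have hstep : ∀ (f : EuclideanSpace ℝ (Fin n) → 𝕜) (j : ℤ),
      ∀ t ∈ Set.Ioc (D * b ^ j) (D * b ^ Order.succ j),
      ENNReal.ofReal t ^ (1 / p) * rearrangement f t ≤ ENNReal.ofReal b ^ (1 / p) *
        (ENNReal.ofReal (D * b ^ j) ^ (1 / p) * rearrangement f (D * b ^ j)) := by
    intro f j t ht
    rw [← mul_assoc, ← ENNReal.mul_rpow_of_nonneg _ _ hp', ← ENNReal.ofReal_mul (by positivity)]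
    have h2 : t ≤ b * (D * b ^ j) := by
      refine ht.2.trans_eq ?_
      rw [Order.succ_eq_add_one, zpow_add_one₀ hb0]
      ring
    gcongr
    exact rearrangement_antitone f ht.1.le
  by_cases h : r = ∞
  · refine ⟨ENNReal.ofReal b ^ (1 / p), by simp [hp.le], fun f => ?_⟩
    simp only [lorentzNorm, seqNorm, h, if_true]
    refine iSup₂_le fun t ht => ?_
    have ht' : t ∈ Set.Ioi (0 : ℝ) := ht
    rw [← iUnion_Ioc_mul_zpow hD hb, Set.mem_iUnion] at ht'
    obtain ⟨j, hj⟩ := ht'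
    refine (hstep f j t hj).trans ?_
    gcongr
    exact le_iSup (fun j : ℤ => ENNReal.ofReal (D * b ^ j) ^ (1 / p) *
      rearrangement f (D * b ^ j)) j
  · have hr' : 0 < r.toReal := ENNReal.toReal_pos hr.ne' h
    -- `b^{1/p}` is the cost of moving `t` to the left endpoint of its mesh interval; `b - 1` is the
    -- interval length divided by that endpoint, which bounds its `dt/t` mass.
    refine ⟨((ENNReal.ofReal b ^ (1 / p)) ^ r.toReal * ENNReal.ofReal (b - 1)) ^ (1 / r.toReal),
      ?_, fun f => ?_⟩
    · refine ENNReal.rpow_ne_top_of_nonneg (by positivity) (ENNReal.mul_ne_top ?_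
        ENNReal.ofReal_ne_top)
      exact ENNReal.rpow_ne_top_of_nonneg hr'.le
        (ENNReal.rpow_ne_top_of_nonneg hp' ENNReal.ofReal_ne_top)
    simp only [lorentzNorm, seqNorm, h, if_false]
    rw [← ENNReal.mul_rpow_of_nonneg _ _ (by positivity : 0 ≤ 1 / r.toReal)]
    gcongr
    rw [lintegral_Ioi_eq_tsum hD hb, ← ENNReal.tsum_mul_left]
    refine ENNReal.tsum_le_tsum fun j => ?_
    have hj : 0 < D * b ^ j := by positivity
    calc ∫⁻ t in Set.Ioc (D * b ^ j) (D * b ^ Order.succ j),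
          (ENNReal.ofReal t ^ (1 / p) * rearrangement f t) ^ r.toReal / ENNReal.ofReal t
        ≤ ∫⁻ _ in Set.Ioc (D * b ^ j) (D * b ^ Order.succ j), (ENNReal.ofReal b ^ (1 / p) *
            (ENNReal.ofReal (D * b ^ j) ^ (1 / p) * rearrangement f (D * b ^ j))) ^ r.toReal
              / ENNReal.ofReal (D * b ^ j) := by
          refine setLIntegral_mono' measurableSet_Ioc fun t ht => ?_
          exact ENNReal.div_le_div (ENNReal.rpow_le_rpow (hstep f j t ht) hr'.le)
            (ENNReal.ofReal_le_ofReal ht.1.le)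
      _ = _ := by
          rw [setLIntegral_const, volume_Ioc_mul_zpow D hb, ENNReal.mul_rpow_of_nonneg _ _ hr'.le]
          generalize (ENNReal.ofReal (D * b ^ j) ^ (1 / p) * rearrangement f (D * b ^ j))
            ^ r.toReal = X
          generalize (ENNReal.ofReal b ^ (1 / p)) ^ r.toReal = Y
          rw [mul_comm (ENNReal.ofReal (b - 1)), ← mul_assoc, ENNReal.div_mul_cancel
            (by simpa using hj) ENNReal.ofReal_ne_top]
          ring

/-- The values of a monotone profile on a geometric mesh are controlled by its Lorentz
quasi-norm. -/
theorem exists_seqNorm_le_lorentzNorm {𝕜 : Type*} [RCLike 𝕜] {n : ℕ} {p : ℝ} (hp : 0 < p)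
    {r : ℝ≥0∞} (hr : 0 < r) {D b : ℝ} (hD : 0 < D) (hb : 1 < b) :
    ∃ C : ℝ≥0∞, C ≠ ∞ ∧ ∀ f : EuclideanSpace ℝ (Fin n) → 𝕜,
      (seqNorm r fun j : ℤ =>
        ENNReal.ofReal (D * b ^ j) ^ (1 / p) * rearrangement f (D * b ^ j)) ≤
      C * lorentzNorm p r f := by
  have hp' : 0 ≤ 1 / p := by positivity
  have hb0 : b ≠ 0 := by positivity
  by_cases h : r = ∞
  · refine ⟨1, ENNReal.one_ne_top, fun f => ?_⟩
    simp only [lorentzNorm, seqNorm, h, if_true, one_mul]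
    refine iSup_le fun j => ?_
    exact le_iSup₂ (f := fun (t : ℝ) (_ : 0 < t) => ENNReal.ofReal t ^ (1 / p) *
      rearrangement f t) (D * b ^ j) (by positivity)
  · have hr' : 0 < r.toReal := ENNReal.toReal_pos hr.ne' h
    have hbb : ENNReal.ofReal ((b - 1) / b) ≠ 0 := by
      simp only [ne_eq, ENNReal.ofReal_eq_zero, not_le]
      exact div_pos (by linarith) (by linarith)
    -- Here `dt/t` is bounded from below, so the interval length is divided by the right endpoint,
    -- giving `(b - 1) / b`.
    refine ⟨((ENNReal.ofReal b ^ (1 / p)) ^ r.toReal *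
      (ENNReal.ofReal ((b - 1) / b))⁻¹) ^ (1 / r.toReal), ?_, fun f => ?_⟩
    · refine ENNReal.rpow_ne_top_of_nonneg (by positivity) (ENNReal.mul_ne_top ?_
        (ENNReal.inv_ne_top.2 hbb))
      exact ENNReal.rpow_ne_top_of_nonneg hr'.le
        (ENNReal.rpow_ne_top_of_nonneg hp' ENNReal.ofReal_ne_top)
    simp only [lorentzNorm, seqNorm, h, if_false]
    rw [← ENNReal.mul_rpow_of_nonneg _ _ (by positivity : 0 ≤ 1 / r.toReal)]
    gcongr
    -- The shift by one pairs each sample with the interval ending at its mesh point, where the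
    -- antitone rearrangement is at least the sample.
    rw [lintegral_Ioi_eq_tsum hD hb, ← ENNReal.tsum_mul_left, ← (Equiv.addRight (1 : ℤ)).tsum_eq]
    refine ENNReal.tsum_le_tsum fun j => ?_
    have hj : 0 < D * b ^ j := by positivity
    simp only [Equiv.coe_addRight, ← Order.succ_eq_add_one]
    have hsucc : D * b ^ Order.succ j = b * (D * b ^ j) := by
      rw [Order.succ_eq_add_one, zpow_add_one₀ hb0]
      ring
    calc (ENNReal.ofReal (D * b ^ Order.succ j) ^ (1 / p) *
            rearrangement f (D * b ^ Order.succ j)) ^ r.toReal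
        = (ENNReal.ofReal b ^ (1 / p)) ^ r.toReal * (ENNReal.ofReal ((b - 1) / b))⁻¹ *
          ∫⁻ _ in Set.Ioc (D * b ^ j) (D * b ^ Order.succ j),
            (ENNReal.ofReal (D * b ^ j) ^ (1 / p) * rearrangement f (D * b ^ Order.succ j))
              ^ r.toReal / ENNReal.ofReal (D * b ^ Order.succ j) := by
          have e1 : ENNReal.ofReal (D * b ^ Order.succ j) ^ (1 / p) *
              rearrangement f (D * b ^ Order.succ j) = ENNReal.ofReal b ^ (1 / p) *
              (ENNReal.ofReal (D * b ^ j) ^ (1 / p) *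
                rearrangement f (D * b ^ Order.succ j)) := by
            rw [hsucc, ENNReal.ofReal_mul (by positivity), ENNReal.mul_rpow_of_nonneg _ _ hp',
              mul_assoc]
          have e2 : ENNReal.ofReal (b - 1) * ENNReal.ofReal (D * b ^ j) =
              ENNReal.ofReal ((b - 1) / b) * ENNReal.ofReal (D * b ^ Order.succ j) := by
            rw [hsucc, ← ENNReal.ofReal_mul (by linarith), ← ENNReal.ofReal_mul
              (div_nonneg (by linarith) (by linarith))]
            congr 1
            field_simp
          rw [e1, setLIntegral_const, volume_Ioc_mul_zpow D hb, e2,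
            ENNReal.mul_rpow_of_nonneg _ _ hr'.le]
          have hs : ENNReal.ofReal (D * b ^ Order.succ j) ≠ 0 := by
            rw [hsucc]
            simp only [ne_eq, ENNReal.ofReal_eq_zero, not_le]
            positivity
          generalize (ENNReal.ofReal (D * b ^ j) ^ (1 / p) *
            rearrangement f (D * b ^ Order.succ j)) ^ r.toReal = X
          generalize (ENNReal.ofReal b ^ (1 / p)) ^ r.toReal = Y
          rw [mul_comm (ENNReal.ofReal ((b - 1) / b)), ← mul_assoc (X / _), ENNReal.div_mul_cancel
            hs ENNReal.ofReal_ne_top, mul_comm X, mul_assoc, ← mul_assoc _ _ X,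
            ENNReal.inv_mul_cancel hbb ENNReal.ofReal_ne_top, one_mul]
      _ ≤ _ := by
          refine mul_le_mul' le_rfl (setLIntegral_mono' measurableSet_Ioc fun t ht => ?_)
          exact ENNReal.div_le_div (ENNReal.rpow_le_rpow (mul_le_mul' (ENNReal.rpow_le_rpow
            (ENNReal.ofReal_le_ofReal ht.1.le) hp') (rearrangement_antitone f ht.2)) hr'.le)
            (ENNReal.ofReal_le_ofReal ht.2)

/-! ### Powers of two and an approximation device in `[0, ∞]`. -/

theorem two_rpow_add (x y : ℝ) : (2 : ℝ≥0∞) ^ (x + y) = 2 ^ x * 2 ^ y :=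
  ENNReal.rpow_add x y two_ne_zero ENNReal.ofNat_ne_top

theorem two_rpow_ne_zero (x : ℝ) : (2 : ℝ≥0∞) ^ x ≠ 0 := by simp

theorem two_rpow_ne_top (x : ℝ) : (2 : ℝ≥0∞) ^ x ≠ ∞ :=
  by simp [ENNReal.rpow_eq_top_iff]

theorem two_rpow_pow (x : ℝ) (m : ℕ) : ((2 : ℝ≥0∞) ^ x) ^ m = 2 ^ (x * m) := by
  rw [← ENNReal.rpow_natCast, ← ENNReal.rpow_mul]

theorem two_rpow_le {x y : ℝ} (h : x ≤ y) : (2 : ℝ≥0∞) ^ x ≤ 2 ^ y :=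
  ENNReal.rpow_le_rpow_of_exponent_le ENNReal.one_lt_two.le h

theorem two_rpow_lt_one {x : ℝ} (h : x < 0) : (2 : ℝ≥0∞) ^ x < 1 :=
  ENNReal.rpow_lt_one_of_one_lt_of_neg ENNReal.one_lt_two h

/-- Replaces a supremum `S`, possibly `0` or `∞`, by a finite `M > S`. Such an `M` is nonzero and
can scale a level; the strictness also passes to the rearrangement, so its infimum need not be
attained. -/
theorem le_mul_of_forall_gt {x C S : ℝ≥0∞} (hC : C ≠ 0) (hC' : C ≠ ∞)
    (h : ∀ M, S < M → M ≠ ∞ → x ≤ C * M) : x ≤ C * S := by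
  rw [mul_comm, ← ENNReal.div_le_iff hC hC']
  refine le_of_forall_gt_imp_ge_of_dense fun M hM => ?_
  by_cases hM' : M = ∞
  · simp [hM']
  · rw [ENNReal.div_le_iff hC hC', mul_comm]
    exact h M hM hM'

/-! ### Integration over geometric layers. -/

/-- A function whose superlevel sets decay geometrically along a geometric sequence of levels is
`q`-integrable on sets of bounded measure. -/
theorem setLIntegral_rpow_le_of_geometric {α : Type*} [MeasurableSpace α] {μ : Measure α}
    {u : α → ℝ≥0∞} (hu : AEMeasurable u μ) (hfin : ∀ x, u x ≠ ∞) {A : Set α}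
    (hA : MeasurableSet A) {T L R β : ℝ≥0∞} {q : ℝ} (hq : 0 < q) (hL : L ≠ 0) (hR : 1 < R)
    (hAT : μ A ≤ T) (hlev : ∀ m : ℕ, μ {x | L * R ^ m < u x} ≤ T * β ^ m) :
    ∫⁻ x in A, u x ^ q ∂μ ≤ (1 + R ^ q * (1 - R ^ q * β)⁻¹) * (L ^ q * T) := by
  have hbound : ∀ (S : Set α) (c : ℝ≥0∞), NullMeasurableSet S μ → (∀ x ∈ S, u x ≤ c) →
      ∫⁻ x in S, u x ^ q ∂μ ≤ c ^ q * μ S := by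
    intro S c hS hc
    rw [← setLIntegral_const]
    refine lintegral_mono_ae ((ae_restrict_iff'₀ hS).2 (ae_of_all _ fun x hx => ?_))
    exact ENNReal.rpow_le_rpow (hc x hx) hq.le
  -- Only the bottom layer `u ≤ L` uses the measure of `A`; the higher layers are measured by the
  -- superlevel sets.
  have hcover : A ⊆ (A ∩ u ⁻¹' Set.Iic L) ∪
      ⋃ m : ℕ, u ⁻¹' Set.Ioc (L * R ^ m) (L * R ^ (m + 1)) := by
    intro x hx
    by_cases hxL : u x ≤ L
    · exact Or.inl ⟨hx, hxL⟩
    refine Or.inr ?_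
    have hex : ∃ m : ℕ, u x ≤ L * R ^ m := by
      have ht := ENNReal.Tendsto.const_mul (a := L)
        (ENNReal.tendsto_pow_atTop_nhds_top_iff.2 hR) (Or.inl ENNReal.top_ne_zero)
      rw [ENNReal.mul_top hL] at ht
      exact (ht.eventually (lt_mem_nhds (hfin x).lt_top)).exists.imp fun m hm => hm.le
    classical
    obtain ⟨k, hk⟩ : ∃ k, Nat.find hex = k + 1 := by
      refine Nat.exists_eq_succ_of_ne_zero fun h0 => hxL ?_
      simpa [h0] using Nat.find_spec hex
    refine Set.mem_iUnion.2 ⟨k, ?_, ?_⟩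
    · exact not_le.1 (Nat.find_min hex (m := k) (by omega))
    · have := Nat.find_spec hex
      rwa [hk] at this
  have hterm : ∀ m : ℕ, ∫⁻ x in u ⁻¹' Set.Ioc (L * R ^ m) (L * R ^ (m + 1)), u x ^ q ∂μ ≤
      R ^ q * (L ^ q * T) * (R ^ q * β) ^ m := by
    intro m
    refine (hbound _ _ (hu.nullMeasurable measurableSet_Ioc) fun x hx => hx.2).trans ?_
    calc (L * R ^ (m + 1)) ^ q * μ (u ⁻¹' Set.Ioc (L * R ^ m) (L * R ^ (m + 1)))
        ≤ (L * R ^ (m + 1)) ^ q * (T * β ^ m) := by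
          gcongr
          exact (measure_mono fun x hx => hx.1).trans (hlev m)
      _ = R ^ q * (L ^ q * T) * (R ^ q * β) ^ m := by
          have : (R ^ (m + 1)) ^ q = (R ^ q) ^ (m + 1) := by
            rw [← ENNReal.rpow_natCast, ← ENNReal.rpow_natCast, ← ENNReal.rpow_mul,
              ← ENNReal.rpow_mul, mul_comm q]
          rw [ENNReal.mul_rpow_of_nonneg _ _ hq.le, this]
          ring
  calc ∫⁻ x in A, u x ^ q ∂μ
      ≤ ∫⁻ x in A ∩ u ⁻¹' Set.Iic L, u x ^ q ∂μ +
        ∑' m : ℕ, ∫⁻ x in u ⁻¹' Set.Ioc (L * R ^ m) (L * R ^ (m + 1)), u x ^ q ∂μ := by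
        refine (lintegral_mono_set hcover).trans ((lintegral_union_le _ _ _).trans ?_)
        gcongr
        exact lintegral_iUnion_le _ _
    _ ≤ L ^ q * T + ∑' m : ℕ, R ^ q * (L ^ q * T) * (R ^ q * β) ^ m := by
        refine add_le_add ((hbound _ L (hA.nullMeasurableSet.inter
          (hu.nullMeasurable measurableSet_Iic)) fun x hx => hx.2).trans ?_)
          (ENNReal.tsum_le_tsum hterm)
        gcongr
        exact (measure_mono Set.inter_subset_left).trans hAT
    _ = (1 + R ^ q * (1 - R ^ q * β)⁻¹) * (L ^ q * T) := by
        -- No convergence condition is needed: for `1 ≤ R ^ q * β` truncated subtraction makes the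
        -- inverse `∞`, as is the series.
        rw [ENNReal.tsum_mul_left, ENNReal.tsum_geometric]
        ring

variable {𝕜 : Type*} [RCLike 𝕜] {n : ℕ}

/-! ### Power weights, dyadic annuli and volumes. -/

/-- Multiplication by the power weight `|x|^s`. -/
def powerWeight (s : ℝ) (f : EuclideanSpace ℝ (Fin n) → 𝕜) : EuclideanSpace ℝ (Fin n) → 𝕜 :=
  fun x => ((‖x‖ ^ s : ℝ) : 𝕜) * f x

theorem measurableSet_annulus (n : ℕ) (j : ℤ) : MeasurableSet (annulus n j) :=
  (measurableSet_le measurable_const measurable_norm).inter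
    (measurableSet_lt measurable_norm measurable_const)

theorem enorm_powerWeight (s : ℝ) (f : EuclideanSpace ℝ (Fin n) → 𝕜)
    (x : EuclideanSpace ℝ (Fin n)) :
    ‖powerWeight s f x‖ₑ = ENNReal.ofReal (‖x‖ ^ s) * ‖f x‖ₑ := by
  have h : 0 ≤ ‖x‖ ^ s := by positivity
  rw [powerWeight, enorm_mul, ← ofReal_norm (_ : 𝕜), RCLike.norm_ofReal, abs_of_nonneg h]

theorem aemeasurable_enorm_powerWeight (s : ℝ) {f : EuclideanSpace ℝ (Fin n) → 𝕜}
    (hf : AEStronglyMeasurable f volume) :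
    AEMeasurable (fun x => ‖powerWeight s f x‖ₑ) volume := by
  simp_rw [enorm_powerWeight]
  exact (measurable_norm.pow_const s).ennreal_ofReal.aemeasurable.mul hf.enorm

/-- Since `log₂ ‖x‖` lies in `[j - 1, j)`, the weight differs from `2^{js}` by a factor of at most
`2^{|s|}` either way. The absolute value covers both signs of `s`. -/
theorem exists_rpow_of_mem_annulus {j : ℤ} {x : EuclideanSpace ℝ (Fin n)}
    (hx : x ∈ annulus n j) (s : ℝ) : ∃ y : ℝ, |y - j * s| ≤ |s| ∧
      ENNReal.ofReal (‖x‖ ^ s) = 2 ^ y := by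
  have hpos : 0 < ‖x‖ := lt_of_lt_of_le (by positivity) hx.1
  set l := Real.logb 2 ‖x‖ with hl
  have hxl : ‖x‖ = 2 ^ l := (Real.rpow_logb (by norm_num) (by norm_num) hpos).symm
  have h1 : (j : ℝ) - 1 ≤ l := by
    rw [hl, Real.le_logb_iff_rpow_le (by norm_num) hpos]
    have := hx.1
    rwa [← Real.rpow_intCast, Int.cast_sub, Int.cast_one] at this
  have h2 : l < j := by
    rw [hl, Real.logb_lt_iff_lt_rpow (by norm_num) hpos, Real.rpow_intCast]
    exact hx.2
  refine ⟨l * s, ?_, ?_⟩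
  · rw [← sub_mul, abs_mul]
    exact mul_le_of_le_one_left (abs_nonneg s) (abs_le.2 ⟨by linarith, by linarith⟩)
  · rw [hxl, ← Real.rpow_mul (by norm_num), ← ENNReal.ofReal_rpow_of_pos (by norm_num),
      ENNReal.ofReal_ofNat]

theorem enorm_powerWeight_le {j : ℤ} {x : EuclideanSpace ℝ (Fin n)} (hx : x ∈ annulus n j)
    (s : ℝ) (f : EuclideanSpace ℝ (Fin n) → 𝕜) :
    ‖powerWeight s f x‖ₑ ≤ 2 ^ (|s| + j * s) * ‖f x‖ₑ := by
  obtain ⟨y, hy, hxy⟩ := exists_rpow_of_mem_annulus hx s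
  rw [enorm_powerWeight, hxy]
  refine mul_le_mul' (two_rpow_le ?_) le_rfl
  linarith [(abs_le.1 hy).2]

theorem enorm_le_powerWeight {j : ℤ} {x : EuclideanSpace ℝ (Fin n)} (hx : x ∈ annulus n j)
    (s : ℝ) (f : EuclideanSpace ℝ (Fin n) → 𝕜) :
    ‖f x‖ₑ ≤ 2 ^ (|s| - j * s) * ‖powerWeight s f x‖ₑ := by
  obtain ⟨y, hy, hxy⟩ := exists_rpow_of_mem_annulus hx s
  rw [enorm_powerWeight, hxy, ← mul_assoc, ← two_rpow_add]
  nth_rw 1 [← one_mul ‖f x‖ₑ, ← ENNReal.rpow_zero (x := 2)]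
  refine mul_le_mul' (two_rpow_le ?_) le_rfl
  linarith [(abs_le.1 hy).1]

/-- The volume of the unit ball. -/
def unitBallVolume (n : ℕ) : ℝ :=
  (volume (Metric.ball (0 : EuclideanSpace ℝ (Fin n)) 1)).toReal

theorem unitBallVolume_pos (n : ℕ) : 0 < unitBallVolume n :=
  ENNReal.toReal_pos (Metric.measure_ball_pos _ _ one_pos).ne' measure_ball_lt_top.ne

theorem ofReal_two_pow_zpow (n : ℕ) (j : ℤ) :
    ENNReal.ofReal ((2 ^ n) ^ j) = 2 ^ ((n : ℝ) * j) := by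
  rw [← ENNReal.ofReal_ofNat 2, ENNReal.ofReal_rpow_of_pos (by norm_num),
    Real.rpow_mul (by norm_num), Real.rpow_natCast, Real.rpow_intCast]

theorem ofReal_mesh {D : ℝ} (hD : 0 < D) (n : ℕ) (j : ℤ) :
    ENNReal.ofReal (D * (2 ^ n) ^ j) = ENNReal.ofReal D * 2 ^ ((n : ℝ) * j) := by
  rw [ENNReal.ofReal_mul hD.le, ofReal_two_pow_zpow]

theorem volume_ball_two_zpow (hn : 1 ≤ n) (k : ℤ) :
    volume (Metric.ball (0 : EuclideanSpace ℝ (Fin n)) (2 ^ k)) =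
      ENNReal.ofReal (unitBallVolume n) * 2 ^ ((n : ℝ) * k) := by
  have : Nonempty (Fin n) := ⟨⟨0, hn⟩⟩
  rw [Measure.addHaar_ball _ _ (by positivity), unitBallVolume,
    ENNReal.ofReal_toReal measure_ball_lt_top.ne, mul_comm, finrank_euclideanSpace_fin,
    ← ofReal_two_pow_zpow, ← zpow_natCast, ← zpow_natCast, ← zpow_mul, ← zpow_mul, mul_comm k]

theorem volume_annulus_le (hn : 1 ≤ n) (k : ℤ) :
    volume (annulus n k) ≤ ENNReal.ofReal (unitBallVolume n) * 2 ^ ((n : ℝ) * k) := by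
  rw [← volume_ball_two_zpow hn]
  exact measure_mono fun x hx => by simpa using hx.2

/-- The strict inequality supplies an admissible level below `l`, and the superlevel sets are
nested. -/
theorem volume_lt_le_of_rearrangement_lt {g : EuclideanSpace ℝ (Fin n) → 𝕜} {t : ℝ} {l : ℝ≥0∞}
    (h : rearrangement g t < l) : volume {x | l < ‖g x‖ₑ} ≤ ENNReal.ofReal t := by
  obtain ⟨a, ha, hal⟩ := sInf_lt_iff.1 h
  exact (measure_mono fun x hx => hal.trans hx).trans ha.2

/-! ### The case `s < st`: annuli controlled by smaller scales. -/

/-- On each dyadic annulus, the `L^q` norm is controlled by the rearrangement of the weighted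
function at all smaller scales. -/
theorem exists_annulus_eLpNorm_le {s st p : ℝ} {q : ℝ≥0∞} (hn : 1 ≤ n) (hp : 0 < p) (hq : 0 < q)
    (hexp : s / n + (q⁻¹).toReal = st / n + 1 / p) (hst : s < st) :
    ∃ C : ℝ≥0∞, C ≠ ∞ ∧ ∀ f : EuclideanSpace ℝ (Fin n) → 𝕜, AEStronglyMeasurable f volume →
      ∀ j : ℤ, (2 : ℝ≥0∞) ^ ((j : ℝ) * s) * eLpNorm ((annulus n j).indicator f) q volume ≤
        C * ⨆ m : ℕ, ((2 : ℝ≥0∞) ^ (-((st - s) / 2))) ^ m *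
          (ENNReal.ofReal (unitBallVolume n * (2 ^ n) ^ (j - m)) ^ (1 / p) *
            rearrangement (powerWeight st f) (unitBallVolume n * (2 ^ n) ^ (j - m))) := by
  have hn0 : (0 : ℝ) < n := by exact_mod_cast hn
  have hDpos := unitBallVolume_pos n
  set D := unitBallVolume n
  -- With `1/q = 0` the scaling relation would force `s > st`.
  have hq_top : q ≠ ∞ := by
    rintro rfl
    have h1 : s / n < st / n := by gcongr
    have h2 : 0 < 1 / p := by positivity
    simp only [ENNReal.inv_top, ENNReal.toReal_zero] at hexp
    linarith
  set e := q.toReal with he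
  have he0 : 0 < e := ENNReal.toReal_pos hq.ne' hq_top
  have hscale : n / e - n / p = st - s := by
    rw [ENNReal.toReal_inv, ← he] at hexp
    field_simp at hexp ⊢
    linarith
  set d := ENNReal.ofReal D with hd
  have hd0 : d ≠ 0 := by simpa [hd] using hDpos
  have hdt : d ≠ ∞ := ENNReal.ofReal_ne_top
  set ε := (st - s) / 2 with hε
  have hε0 : 0 < ε := by rw [hε]; linarith
  -- The exponent is the midpoint of `n/p` and `n/e`: the excess `ε` over `n/p` absorbs the damping,
  -- and the deficit `ε` below `n/e` gives `R ^ e * β = 2^{-εe} < 1`.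
  set R : ℝ≥0∞ := 2 ^ (ε + n / p) with hR
  set β : ℝ≥0∞ := 2 ^ (-(n : ℝ)) with hβ
  have hRβ : R ^ e * β < 1 := by
    rw [hR, hβ, ← ENNReal.rpow_mul, ← two_rpow_add]
    apply two_rpow_lt_one
    have h : (ε + n / p - n / e) * e < 0 := mul_neg_of_neg_of_pos (by linarith) he0
    have h' : (n : ℝ) / e * e = n := by field_simp
    linarith
  set K : ℝ≥0∞ := 1 + R ^ e * (1 - R ^ e * β)⁻¹ with hK
  have hK0 : K ≠ 0 := by simp [hK]
  have hKt : K ≠ ∞ := by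
    refine ENNReal.add_ne_top.2 ⟨ENNReal.one_ne_top, ENNReal.mul_ne_top
      (ENNReal.rpow_ne_top_of_nonneg he0.le (two_rpow_ne_top _)) ?_⟩
    simpa [tsub_eq_zero_iff_le] using hRβ
  have hCt : (2 : ℝ≥0∞) ^ |st| * (K ^ (1 / e) * d ^ (1 / e - 1 / p)) ≠ ∞ :=
    ENNReal.mul_ne_top (two_rpow_ne_top _) (ENNReal.mul_ne_top
      (ENNReal.rpow_ne_top_of_nonneg (by positivity) hKt)
      (by simp [ENNReal.rpow_eq_top_iff, hd0, hdt]))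
  refine ⟨2 ^ |st| * (K ^ (1 / e) * d ^ (1 / e - 1 / p)), hCt, fun f hf j => ?_⟩
  refine le_mul_of_forall_gt ?_ hCt fun M hM hMt => ?_
  · have h1 : K ^ (1 / e) ≠ 0 := by simp [ENNReal.rpow_eq_zero_iff, hK0, hKt]
    have h2 : d ^ (1 / e - 1 / p) ≠ 0 := by simp [ENNReal.rpow_eq_zero_iff, hd0, hdt]
    exact mul_ne_zero (two_rpow_ne_zero _) (mul_ne_zero h1 h2)
  have hM0 : M ≠ 0 := (bot_le.trans_lt hM).ne'
  -- `L` is `M t^{-1/p}` at `t = D 2^{nj}`. At `t_m = D 2^{n(j-m)}` the bound by `M` then reads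
  -- exactly `g*(t_m) < L R^m`.
  set L : ℝ≥0∞ := M * (d ^ (-(1 / p)) * 2 ^ (-(n * j / p))) with hL
  have hL0 : L ≠ 0 := mul_ne_zero hM0 (mul_ne_zero
    (by simp [ENNReal.rpow_eq_zero_iff, hd0, hdt]) (two_rpow_ne_zero _))
  have hlev : ∀ m : ℕ, volume {x | L * R ^ m < ‖powerWeight st f x‖ₑ} ≤
      d * 2 ^ ((n : ℝ) * j) * β ^ m := by
    intro m
    have hTm : ENNReal.ofReal (D * (2 ^ n) ^ (j - m)) = d * 2 ^ ((n : ℝ) * j) * β ^ m := by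
      rw [ofReal_mesh hDpos, hβ, two_rpow_pow, mul_assoc, ← two_rpow_add]
      congr 2
      push_cast
      ring
    rw [← hTm]
    refine volume_lt_le_of_rearrangement_lt ?_
    have h1 := (le_iSup (fun m : ℕ => ((2 : ℝ≥0∞) ^ (-ε)) ^ m *
      (ENNReal.ofReal (D * (2 ^ n) ^ (j - m)) ^ (1 / p) *
        rearrangement (powerWeight st f) (D * (2 ^ n) ^ (j - m)))) m).trans_lt hM
    generalize rearrangement (powerWeight st f) (D * (2 ^ n) ^ (j - m)) = ρ at h1 ⊢
    have hc : ((2 : ℝ≥0∞) ^ (-ε)) ^ m * (d * 2 ^ ((n : ℝ) * j) * β ^ m) ^ (1 / p) =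
        d ^ (1 / p) * 2 ^ (-(ε * m) + (n * j / p) - n * m / p) := by
      rw [two_rpow_pow, hβ, two_rpow_pow, mul_assoc, ← two_rpow_add,
        ENNReal.mul_rpow_of_nonneg _ _ (by positivity), ← ENNReal.rpow_mul, mul_left_comm,
        ← two_rpow_add]
      congr 2
      ring
    have hcL : L * R ^ m * (d ^ (1 / p) * 2 ^ (-(ε * m) + (n * j / p) - n * m / p)) = M := by
      have e1 : d ^ (-(1 / p)) * d ^ (1 / p) = 1 := by
        rw [← ENNReal.rpow_add _ _ hd0 hdt, neg_add_cancel, ENNReal.rpow_zero]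
      have e2 : (2 : ℝ≥0∞) ^ (-(n * j / p)) * 2 ^ ((ε + n / p) * m) *
          2 ^ (-(ε * m) + (n * j / p) - n * m / p) = 1 := by
        rw [← two_rpow_add, ← two_rpow_add, ← ENNReal.rpow_zero (x := 2)]
        congr 1
        ring
      rw [hL, hR, two_rpow_pow]
      calc _ = M * (d ^ (-(1 / p)) * d ^ (1 / p)) * ((2 : ℝ≥0∞) ^ (-(n * j / p)) *
            2 ^ ((ε + n / p) * m) * 2 ^ (-(ε * m) + (n * j / p) - n * m / p)) := by ring
        _ = M := by rw [e1, e2, mul_one, mul_one]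
    rw [hTm, ← mul_assoc, hc, ← hcL, mul_comm] at h1
    exact lt_of_mul_lt_mul_right' h1
  have hmain := setLIntegral_rpow_le_of_geometric (aemeasurable_enorm_powerWeight st hf)
    (fun x => enorm_ne_top) (measurableSet_annulus n j) he0 hL0
    (show 1 < R from ENNReal.one_lt_rpow ENNReal.one_lt_two (by positivity))
    (volume_annulus_le hn j) hlev
  have hint : ∫⁻ x in annulus n j, ‖f x‖ₑ ^ e ≤
      (2 ^ (|st| - j * st)) ^ e * (K * (L ^ e * (d * 2 ^ ((n : ℝ) * j)))) := by
    calc ∫⁻ x in annulus n j, ‖f x‖ₑ ^ e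
        ≤ ∫⁻ x in annulus n j, (2 ^ (|st| - j * st)) ^ e * ‖powerWeight st f x‖ₑ ^ e := by
          refine setLIntegral_mono' (measurableSet_annulus n j) fun x hx => ?_
          rw [← ENNReal.mul_rpow_of_nonneg _ _ he0.le]
          exact ENNReal.rpow_le_rpow (enorm_le_powerWeight hx st f) he0.le
      _ ≤ _ := by
          rw [lintegral_const_mul' _ _
            (ENNReal.rpow_ne_top_of_nonneg he0.le (two_rpow_ne_top _))]
          exact mul_le_mul' le_rfl hmain
  have hpow : ∀ a : ℝ≥0∞, (a ^ e) ^ (1 / e) = a := fun a => by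
    rw [← ENNReal.rpow_mul, mul_one_div_cancel he0.ne', ENNReal.rpow_one]
  have hie : 0 ≤ 1 / e := by positivity
  rw [eLpNorm_indicator_eq_eLpNorm_restrict (measurableSet_annulus n j),
    eLpNorm_eq_lintegral_rpow_enorm_toReal hq.ne' hq_top, ← he]
  calc (2 : ℝ≥0∞) ^ ((j : ℝ) * s) * (∫⁻ x in annulus n j, ‖f x‖ₑ ^ e) ^ (1 / e)
      ≤ 2 ^ ((j : ℝ) * s) *
        ((2 ^ (|st| - j * st)) ^ e * (K * (L ^ e * (d * 2 ^ ((n : ℝ) * j))))) ^ (1 / e) := by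
        gcongr
    _ = (2 ^ ((j : ℝ) * s) * 2 ^ (|st| - j * st) * 2 ^ (-(n * j / p)) * 2 ^ (n * j * (1 / e))) *
        (K ^ (1 / e) * (d ^ (1 / e) * d ^ (-(1 / p)))) * M := by
        simp only [ENNReal.mul_rpow_of_nonneg _ _ hie, hpow]
        rw [← ENNReal.rpow_mul 2 (n * j), hL]
        ring
    _ = _ := by
        rw [← ENNReal.rpow_add _ _ hd0 hdt, ← two_rpow_add, ← two_rpow_add, ← two_rpow_add,
          ← sub_eq_add_neg]
        congr 3
        -- The scaling relation cancels every power of two depending on `j`, so the constant is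
        -- uniform over annuli.
        have : j * (n / e - n / p) = j * (st - s) := by rw [hscale]
        linear_combination this

/-! ### The case `st < s`: rearrangement controlled by larger scales. -/

/-- A weighted Chebyshev estimate, summed over all dyadic annuli outside a ball. -/
theorem exists_tsum_volume_annulus_le {s st p : ℝ} {q : ℝ≥0∞} (hn : 1 ≤ n) (hq : 0 < q)
    (hexp : s / n + (q⁻¹).toReal = st / n + 1 / p) (hst : st < s) :
    ∃ B : ℝ≥0∞, B ≠ 0 ∧ B ≠ ∞ ∧ ∀ f : EuclideanSpace ℝ (Fin n) → 𝕜,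
      AEStronglyMeasurable f volume → ∀ (k : ℤ) (M : ℝ≥0∞), M ≠ 0 → M ≠ ∞ →
      (∀ m : ℕ, ((2 : ℝ≥0∞) ^ (-((s - st) / 2))) ^ m * (2 ^ (((k + m : ℤ) : ℝ) * s) *
        eLpNorm ((annulus n (k + m)).indicator f) q volume) ≤ M) →
      ∑' m : ℕ, volume (annulus n (k + m) ∩
        {x | M * B * 2 ^ (-(n * k / p)) < ‖powerWeight st f x‖ₑ}) ≤
        ENNReal.ofReal (unitBallVolume n) * 2 ^ ((n : ℝ) * k) := by
  have hn0 : (0 : ℝ) < n := by exact_mod_cast hn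
  have hDpos := unitBallVolume_pos n
  set d := ENNReal.ofReal (unitBallVolume n) with hd
  have hd0 : d ≠ 0 := by simpa [hd] using hDpos
  have hdt : d ≠ ∞ := ENNReal.ofReal_ne_top
  set ε := (s - st) / 2 with hε
  have hε0 : 0 < ε := by rw [hε]; linarith
  have hscale : 2 * ε = n * (1 / p) - n * (q⁻¹).toReal := by
    have h1 : n * (s / n + (q⁻¹).toReal) = n * (st / n + 1 / p) := by rw [hexp]
    rw [mul_add, mul_add, mul_div_cancel₀ _ hn0.ne', mul_div_cancel₀ _ hn0.ne'] at h1
    rw [hε]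
    linarith
  -- Passing from weight exponent `s` to `st` on `A_{k+m}` gains `2^{-2ε(k+m)}`. Undoing the damping
  -- costs `2^{εm}`, so decay `2^{-εm}` remains; `2^{-2εk}` is rewritten by the scaling relation.
  have hkey : ∀ (f : EuclideanSpace ℝ (Fin n) → 𝕜) (k : ℤ) (M : ℝ≥0∞) (m : ℕ),
      ((2 : ℝ≥0∞) ^ (-ε)) ^ m * (2 ^ (((k + m : ℤ) : ℝ) * s) *
        eLpNorm ((annulus n (k + m)).indicator f) q volume) ≤ M →
      2 ^ (|st| + ((k + m : ℤ) : ℝ) * st) * eLpNorm ((annulus n (k + m)).indicator f) q volume ≤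
        M * 2 ^ (|st| - n * k / p + n * k * (q⁻¹).toReal - ε * m) := by
    intro f k M m h
    generalize eLpNorm ((annulus n (k + m)).indicator f) q volume = N at h ⊢
    have e1 : |st| + ((k + m : ℤ) : ℝ) * st =
        (-ε * m + ((k + m : ℤ) : ℝ) * s) +
          (|st| - n * k / p + n * k * (q⁻¹).toReal - ε * m) := by
      have h2 : k * (2 * ε) = k * (n * (1 / p) - n * (q⁻¹).toReal) := by rw [hscale]
      have h3 : 2 * ε = s - st := by rw [hε]; ring
      push_cast
      linear_combination (k + m) * h3 - h2
    rw [e1, two_rpow_add, two_rpow_add, ← two_rpow_pow]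
    calc _ = (((2 : ℝ≥0∞) ^ (-ε)) ^ m * (2 ^ (((k + m : ℤ) : ℝ) * s) * N)) *
          2 ^ (|st| - n * k / p + n * k * (q⁻¹).toReal - ε * m) := by ring
      _ ≤ _ := by gcongr
  -- For `q = ∞` the essential bound on each annulus is already at most the level, so every set in
  -- the sum is null.
  by_cases hq_top : q = ∞
  · refine ⟨2 ^ |st|, two_rpow_ne_zero _, two_rpow_ne_top _, fun f hf k M hM0 hMt hM => ?_⟩
    refine le_of_eq_of_le (ENNReal.tsum_eq_zero.2 fun m => ?_) zero_le
    have h1 := hkey f k M m (hM m)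
    rw [hq_top, eLpNorm_exponent_top] at h1
    have h2 := enorm_ae_le_eLpNormEssSup ((annulus n (k + m)).indicator f) volume
    refine measure_mono_null ?_ (ae_iff.1 h2)
    rintro x ⟨hx, hlt⟩ hle
    rw [Set.indicator_of_mem hx] at hle
    refine absurd (hlt.trans_le ((enorm_powerWeight_le hx st f).trans
      ((mul_le_mul' le_rfl hle).trans h1))) (not_lt.2 ?_)
    rw [mul_assoc M, ← two_rpow_add]
    refine mul_le_mul' le_rfl (two_rpow_le ?_)
    have : 0 ≤ ε * m := by positivity
    simp only [ENNReal.inv_top, ENNReal.toReal_zero]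
    linarith
  set e := q.toReal with he
  have he0 : 0 < e := ENNReal.toReal_pos hq.ne' hq_top
  have hqe : (q⁻¹).toReal = 1 / e := by rw [ENNReal.toReal_inv, ← he, one_div]
  set ρ : ℝ≥0∞ := 2 ^ (-(ε * e)) with hρ
  have hρ1 : ρ < 1 := two_rpow_lt_one (by linarith [mul_pos hε0 he0])
  have hG0 : (1 - ρ)⁻¹ ≠ 0 := by simp
  have hGt : (1 - ρ)⁻¹ ≠ ∞ := by simpa [tsub_eq_zero_iff_le] using hρ1
  -- Normalized so that the Chebyshev bounds `W⁻¹ 2^{nk} ρ^m` sum to exactly `d 2^{nk}`, the volume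
  -- of the ball of radius `2^k`.
  set W : ℝ≥0∞ := (1 - ρ)⁻¹ / d with hW
  have hW0 : W ≠ 0 := (ENNReal.div_pos hG0 hdt).ne'
  have hWt : W ≠ ∞ := ENNReal.div_ne_top hGt hd0
  have hWe0 : W ^ (1 / e) ≠ 0 := by simp [ENNReal.rpow_eq_zero_iff, hW0, hWt]
  have hWet : W ^ (1 / e) ≠ ∞ := ENNReal.rpow_ne_top_of_nonneg (by positivity) hWt
  refine ⟨2 ^ |st| * W ^ (1 / e), mul_ne_zero (two_rpow_ne_zero _) hWe0,
    ENNReal.mul_ne_top (two_rpow_ne_top _) hWet, fun f hf k M hM0 hMt hM => ?_⟩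
  have hterm : ∀ m : ℕ, volume (annulus n (k + m) ∩
      {x | M * (2 ^ |st| * W ^ (1 / e)) * 2 ^ (-(n * k / p)) < ‖powerWeight st f x‖ₑ}) ≤
      W⁻¹ * 2 ^ ((n : ℝ) * k) * ρ ^ m := by
    intro m
    have h1 := hkey f k M m (hM m)
    set N := eLpNorm ((annulus n (k + m)).indicator f) q volume with hN
    set c : ℝ≥0∞ := 2 ^ (|st| + ((k + m : ℤ) : ℝ) * st) with hc
    have hc0 : c ≠ 0 := two_rpow_ne_zero _
    have hct : c ≠ ∞ := two_rpow_ne_top _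
    set l : ℝ≥0∞ := M * (2 ^ |st| * W ^ (1 / e)) * 2 ^ (-(n * k / p)) with hl
    have hl0 : l ≠ 0 := mul_ne_zero (mul_ne_zero hM0 (mul_ne_zero (two_rpow_ne_zero _) hWe0))
      (two_rpow_ne_zero _)
    have hlt : l ≠ ∞ := ENNReal.mul_ne_top (ENNReal.mul_ne_top hMt
      (ENNReal.mul_ne_top (two_rpow_ne_top _) hWet)) (two_rpow_ne_top _)
    have hlc0 : l / c ≠ 0 := (ENNReal.div_pos hl0 hct).ne'
    have hlct : l / c ≠ ∞ := ENNReal.div_ne_top hlt hc0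
    calc volume (annulus n (k + m) ∩ {x | l < ‖powerWeight st f x‖ₑ})
        ≤ volume {x | l / c ≤ ‖(annulus n (k + m)).indicator f x‖ₑ} := by
          refine measure_mono ?_
          rintro x ⟨hx, hxl⟩
          change l / c ≤ _
          rw [Set.indicator_of_mem hx, ENNReal.div_le_iff hc0 hct, mul_comm]
          exact (le_of_lt hxl).trans (enorm_powerWeight_le hx st f)
      _ ≤ (l / c)⁻¹ ^ e * N ^ e := meas_ge_le_mul_pow_eLpNorm_enorm volume hq.ne' hq_top
          (hf.indicator (measurableSet_annulus n _)) hlc0 (fun h => absurd h hlct)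
      _ = (c * N / l) ^ e := by
          rw [← ENNReal.mul_rpow_of_nonneg _ _ he0.le, ENNReal.inv_div (Or.inl hct) (Or.inl hc0)]
          congr 1
          simp only [div_eq_mul_inv]
          ring
      _ ≤ ((W ^ (1 / e))⁻¹ * 2 ^ (n * k * (1 / e) - ε * m)) ^ e := by
          refine ENNReal.rpow_le_rpow ?_ he0.le
          rw [ENNReal.div_le_iff hl0 hlt]
          refine h1.trans_eq ?_
          have e1 : |st| - n * k / p + n * k * (q⁻¹).toReal - ε * m =
              (n * k * (1 / e) - ε * m) + |st| + (-(n * k / p)) := by rw [hqe]; ring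
          rw [e1, two_rpow_add, two_rpow_add, hl]
          calc _ = ((W ^ (1 / e))⁻¹ * W ^ (1 / e)) * (M * (2 ^ (n * k * (1 / e) - ε * m) *
                2 ^ |st| * 2 ^ (-(n * k / p)))) := by
                rw [ENNReal.inv_mul_cancel hWe0 hWet, one_mul]
            _ = _ := by ring
      _ = W⁻¹ * 2 ^ ((n : ℝ) * k) * ρ ^ m := by
          rw [ENNReal.mul_rpow_of_nonneg _ _ he0.le, ← ENNReal.inv_rpow, ← ENNReal.rpow_mul,
            one_div_mul_cancel he0.ne', ENNReal.rpow_one, ← ENNReal.rpow_mul, hρ, two_rpow_pow,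
            mul_assoc W⁻¹, ← two_rpow_add]
          congr 2
          field_simp
          ring
  refine (ENNReal.tsum_le_tsum hterm).trans_eq ?_
  rw [ENNReal.tsum_mul_left, ENNReal.tsum_geometric, hW, ENNReal.inv_div (Or.inl hdt) (Or.inl hd0),
    mul_right_comm, ENNReal.div_mul_cancel hG0 hGt]

/-- The rearrangement of the weighted function at a dyadic scale is controlled by the `L^q` norms
on the annuli at all larger scales. -/
theorem exists_rearrangement_le {s st p : ℝ} {q : ℝ≥0∞} (hn : 1 ≤ n) (hp : 0 < p) (hq : 0 < q)
    (hexp : s / n + (q⁻¹).toReal = st / n + 1 / p) (hst : st < s) :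
    ∃ C : ℝ≥0∞, C ≠ ∞ ∧ ∀ f : EuclideanSpace ℝ (Fin n) → 𝕜, AEStronglyMeasurable f volume →
      ∀ k : ℤ, ENNReal.ofReal (2 * unitBallVolume n * (2 ^ n) ^ k) ^ (1 / p) *
          rearrangement (powerWeight st f) (2 * unitBallVolume n * (2 ^ n) ^ k) ≤
        C * ⨆ m : ℕ, ((2 : ℝ≥0∞) ^ (-((s - st) / 2))) ^ m * (2 ^ (((k + m : ℤ) : ℝ) * s) *
          eLpNorm ((annulus n (k + m)).indicator f) q volume) := by
  obtain ⟨B, hB0, hBt, hB⟩ := exists_tsum_volume_annulus_le (𝕜 := 𝕜) hn hq hexp hst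
  have hDpos := unitBallVolume_pos n
  have hip : 0 ≤ 1 / p := by positivity
  -- The factor `2` leaves one ball volume for the ball itself, where nothing is known about `f`,
  -- and one for the tail.
  set d := ENNReal.ofReal (2 * unitBallVolume n) with hd
  have hd0 : d ≠ 0 := by simpa [hd] using hDpos
  have hdt : d ≠ ∞ := ENNReal.ofReal_ne_top
  have hC0 : d ^ (1 / p) * B ≠ 0 :=
    mul_ne_zero (by simp [ENNReal.rpow_eq_zero_iff, hd0, hdt]) hB0
  have hCt : d ^ (1 / p) * B ≠ ∞ :=
    ENNReal.mul_ne_top (ENNReal.rpow_ne_top_of_nonneg hip hdt) hBt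
  refine ⟨d ^ (1 / p) * B, hCt, fun f hf k => le_mul_of_forall_gt hC0 hCt fun M hM hMt => ?_⟩
  have hM0 : M ≠ 0 := (bot_le.trans_lt hM).ne'
  have htail := hB f hf k M hM0 hMt fun m => (le_iSup (fun m : ℕ =>
    ((2 : ℝ≥0∞) ^ (-((s - st) / 2))) ^ m * (2 ^ (((k + m : ℤ) : ℝ) * s) *
      eLpNorm ((annulus n (k + m)).indicator f) q volume)) m).trans hM.le
  set l : ℝ≥0∞ := M * B * 2 ^ (-(n * k / p)) with hl
  have hl0 : l ≠ 0 := mul_ne_zero (mul_ne_zero hM0 hB0) (two_rpow_ne_zero _)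
  have hcover : {x | l < ‖powerWeight st f x‖ₑ} ⊆ Metric.ball 0 (2 ^ k) ∪
      ⋃ m : ℕ, annulus n (k + m) ∩ {x | l < ‖powerWeight st f x‖ₑ} := by
    intro x hx
    by_cases hxb : ‖x‖ < 2 ^ k
    · exact Or.inl (by simpa using hxb)
    rw [not_lt] at hxb
    -- `2^i ≤ ‖x‖ < 2^{i+1}` places `x` in the annulus of index `i + 1`, not `i`.
    obtain ⟨i, hi1, hi2⟩ := exists_mem_Ico_zpow (lt_of_lt_of_le (by positivity) hxb)
      (one_lt_two : (1 : ℝ) < 2)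
    have hki : k < i + 1 := (zpow_lt_zpow_iff_right₀ one_lt_two).1 (hxb.trans_lt hi2)
    obtain ⟨m, hm⟩ := Int.le.dest hki.le
    refine Or.inr (Set.mem_iUnion.2 ⟨m, ?_, hx⟩)
    rw [hm]
    exact ⟨by rwa [add_sub_cancel_right], hi2⟩
  have hvol : volume {x | l < ‖powerWeight st f x‖ₑ} ≤
      ENNReal.ofReal (2 * unitBallVolume n * (2 ^ n) ^ k) := by
    calc volume {x | l < ‖powerWeight st f x‖ₑ}
        ≤ volume (Metric.ball (0 : EuclideanSpace ℝ (Fin n)) (2 ^ k)) +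
          ∑' m : ℕ, volume (annulus n (k + m) ∩ {x | l < ‖powerWeight st f x‖ₑ}) :=
          (measure_mono hcover).trans ((measure_union_le _ _).trans
            (add_le_add le_rfl (measure_iUnion_le _)))
      _ ≤ ENNReal.ofReal (unitBallVolume n) * 2 ^ ((n : ℝ) * k) +
          ENNReal.ofReal (unitBallVolume n) * 2 ^ ((n : ℝ) * k) :=
          add_le_add (volume_ball_two_zpow hn k).le htail
      _ = ENNReal.ofReal (2 * unitBallVolume n * (2 ^ n) ^ k) := by
          rw [ofReal_mesh (by positivity), ENNReal.ofReal_mul (by norm_num), ENNReal.ofReal_ofNat]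
          ring
  have hrearr : rearrangement (powerWeight st f) (2 * unitBallVolume n * (2 ^ n) ^ k) ≤ l :=
    sInf_le ⟨pos_iff_ne_zero.2 hl0, hvol⟩
  calc ENNReal.ofReal (2 * unitBallVolume n * (2 ^ n) ^ k) ^ (1 / p) *
        rearrangement (powerWeight st f) (2 * unitBallVolume n * (2 ^ n) ^ k)
      ≤ (d * 2 ^ ((n : ℝ) * k)) ^ (1 / p) * l := by
        rw [ofReal_mesh (by positivity)]
        exact mul_le_mul' le_rfl hrearr
    _ = d ^ (1 / p) * B * M * (2 ^ (n * k * (1 / p)) * 2 ^ (-(n * k / p))) := by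
        rw [ENNReal.mul_rpow_of_nonneg _ _ hip, ← ENNReal.rpow_mul, hl]
        ring
    _ = d ^ (1 / p) * B * M := by
        rw [← two_rpow_add, mul_one_div, add_neg_cancel, ENNReal.rpow_zero, mul_one]

end HerzLorentz

end

/-! ### Assembly of the two embeddings. -/

theorem proposition5p1 {𝕜 : Type*} [RCLike 𝕜] (n : ℕ) (hn : 1 ≤ n) (s st : ℝ)
    (p : ℝ) (hp : 0 < p) (q r : ℝ≥0∞) (hq : 0 < q) (hr : 0 < r)
    (hexp : s / n + (q⁻¹).toReal = st / n + 1 / p) :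
    (s < st → ∃ C : ℝ≥0, ∀ f : EuclideanSpace ℝ (Fin n) → 𝕜,
      HerzLorentz.MemWeightedLorentz st p r f →
        HerzLorentz.MemHerz s q r f ∧
          HerzLorentz.herzNorm s q r f ≤ C * HerzLorentz.weightedLorentzNorm st p r f) ∧
    (st < s → ∃ C : ℝ≥0, ∀ f : EuclideanSpace ℝ (Fin n) → 𝕜,
      HerzLorentz.MemHerz s q r f →
        HerzLorentz.MemWeightedLorentz st p r f ∧
          HerzLorentz.weightedLorentzNorm st p r f ≤ C * HerzLorentz.herzNorm s q r f) := by
  have hD := HerzLorentz.unitBallVolume_pos n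
  have hb : (1 : ℝ) < 2 ^ n := one_lt_pow₀ one_lt_two (by omega)
  constructor
  · intro hst
    obtain ⟨C₁, hC₁, h₁⟩ :=
      HerzLorentz.exists_annulus_eLpNorm_le (𝕜 := 𝕜) hn hp hq hexp hst
    obtain ⟨C₂, hC₂, h₂⟩ := HerzLorentz.exists_seqNorm_iSup_le hr
      (HerzLorentz.two_rpow_lt_one (show -((st - s) / 2) < 0 by linarith))
      (fun m : ℕ => Equiv.subRight (m : ℤ))
    -- The same bound with the shift equivalence unfolded, so that it matches the annulus estimate
    -- syntactically.
    have h₂' : ∀ a : ℤ → ℝ≥0∞, HerzLorentz.seqNorm r (fun j => ⨆ m : ℕ,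
        ((2 : ℝ≥0∞) ^ (-((st - s) / 2))) ^ m * a (j - m)) ≤ C₂ * HerzLorentz.seqNorm r a := h₂
    obtain ⟨C₃, hC₃, h₃⟩ :=
      HerzLorentz.exists_seqNorm_le_lorentzNorm (𝕜 := 𝕜) (n := n) hp hr hD hb
    have hC := ENNReal.mul_ne_top hC₁ (ENNReal.mul_ne_top hC₂ hC₃)
    refine ⟨(C₁ * (C₂ * C₃)).toNNReal, fun f hf => ?_⟩
    have key : HerzLorentz.herzNorm s q r f ≤
        C₁ * (C₂ * C₃) * HerzLorentz.weightedLorentzNorm st p r f := by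
      rw [HerzLorentz.herzNorm_eq_seqNorm, mul_assoc, mul_assoc]
      refine (HerzLorentz.seqNorm_le_of_le hr (h₁ f hf.1)).trans (mul_le_mul' le_rfl ?_)
      exact (h₂' fun j : ℤ => ENNReal.ofReal (HerzLorentz.unitBallVolume n * (2 ^ n) ^ j) ^ (1 / p) *
        HerzLorentz.rearrangement (HerzLorentz.powerWeight st f)
          (HerzLorentz.unitBallVolume n * (2 ^ n) ^ j)).trans
        (mul_le_mul' le_rfl (h₃ (HerzLorentz.powerWeight st f)))
    rw [ENNReal.coe_toNNReal hC]
    exact ⟨⟨hf.1, key.trans_lt (ENNReal.mul_lt_top hC.lt_top hf.2)⟩, key⟩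
  · intro hst
    obtain ⟨C₁, hC₁, h₁⟩ := HerzLorentz.exists_rearrangement_le (𝕜 := 𝕜) hn hp hq hexp hst
    obtain ⟨C₂, hC₂, h₂⟩ := HerzLorentz.exists_seqNorm_iSup_le hr
      (HerzLorentz.two_rpow_lt_one (show -((s - st) / 2) < 0 by linarith))
      (fun m : ℕ => Equiv.addRight (m : ℤ))
    have h₂' : ∀ a : ℤ → ℝ≥0∞, HerzLorentz.seqNorm r (fun j => ⨆ m : ℕ,
        ((2 : ℝ≥0∞) ^ (-((s - st) / 2))) ^ m * a (j + m)) ≤ C₂ * HerzLorentz.seqNorm r a := h₂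
    obtain ⟨C₃, hC₃, h₃⟩ := HerzLorentz.exists_lorentzNorm_le_seqNorm (𝕜 := 𝕜) (n := n) hp hr
      (show 0 < 2 * HerzLorentz.unitBallVolume n by positivity) hb
    have hC := ENNReal.mul_ne_top hC₃ (ENNReal.mul_ne_top hC₁ hC₂)
    refine ⟨(C₃ * (C₁ * C₂)).toNNReal, fun f hf => ?_⟩
    have key : HerzLorentz.weightedLorentzNorm st p r f ≤
        C₃ * (C₁ * C₂) * HerzLorentz.herzNorm s q r f := by
      rw [HerzLorentz.herzNorm_eq_seqNorm, mul_assoc, mul_assoc]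
      refine (h₃ (HerzLorentz.powerWeight st f)).trans (mul_le_mul' le_rfl ?_)
      exact (HerzLorentz.seqNorm_le_of_le hr (h₁ f hf.1)).trans
        (mul_le_mul' le_rfl (h₂' fun j : ℤ =>
          (2 : ℝ≥0∞) ^ ((j : ℝ) * s) * eLpNorm ((HerzLorentz.annulus n j).indicator f) q volume))
    rw [ENNReal.coe_toNNReal hC]
    exact ⟨⟨hf.1, key.trans_lt (ENNReal.mul_lt_top hC.lt_top hf.2)⟩, key⟩
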